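/- Let $d\in\{2,3\}$ and let $\Omega\subset\mathbb R^d$ be a bounded domain whose boundary has finite surface measure and, almost everywhere, an outward unit normal $\mathbf n$. Let $\partial\Omega=\partial\Omega_d\cup\partial\Omega_o$, where the Dirichlet part $\partial\Omega_d$ and the open part $\partial\Omega_o$ overlap at most in a null set. Let $\nu,D_0,\Delta t,U_0>0$ and $C_0\in\mathbb R$. Write $\mathbf N(\mathbf u)=\mathbf u\cdot\nabla\mathbf u$, $g(\chi)=\min(\chi,1)$, $$E[\mathbf v]=\int_\Omega\tfrac12|\mathbf v|^2d\Omega+\nu D_0\int_{\partial\Omega_o}\tfrac12|\mathbf v|^2dA+C_0,$$ $$\mathbf H(\mathbf n,\mathbf u)=\left[\tfrac12|\mathbf u|^2\mathbf n+\tfrac12(\mathbf n\cdot\mathbf u)\mathbf u\right]\Theta_0(\mathbf n,\mathbf u),\qquad \Theta_0(\mathbf n,\mathbf u)=\tfrac12\left(1-\tanh\frac{\mathbf n\cdot\mathbf u}{U_0\delta}\right),\quad \delta>0 .$$ As $\delta\to0$ the smoothed step $\Theta_0$ tends to the sharp step, which is $1$ where $\mathbf n\cdot\mathbf u<0$ and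 $0$ where $\mathbf n\cdot\mathbf u>0$ (its value where $\mathbf n\cdot\mathbf u=0$ is arbitrary). Consider one step of the following scheme with body force $\mathbf f=0$, external pressure head $p_0=0$, boundary source $\mathbf f_b=0$ and Dirichlet data $\mathbf w=0$. Given $\mathbf u^{n-1},\mathbf u^n,R^{n-1},R^n$, put $\mathbf u^*=2\mathbf u^n-\mathbf u^{n-1}$, $\hat{\mathbf u}=2\mathbf u^n-\frac12\mathbf u^{n-1}$, $\boldsymbol\omega^*=\nabla\times\mathbf u^*$, $R^{n+3/2}=\frac32R^{n+1}-\frac12R^n$, $R^{n+1/2}=\frac32R^n-\frac12R^{n-1}$. The unknowns $\tilde{\mathbf u}^{n+1},p^{n+1},\mathbf u^{n+1},R^{n+1}$ and the auxiliary fields $p_1,p_2,\mathbf u_1,\mathbf u_2$, with $\bar{\mathbf u}^{n+1}=\mathbf u_1+\mathbf u_2$, $\bar{\mathbf u}^{n+3/2}=\frac32\bar{\mathbf u}^{n+1}-\frac12\mathbf u^n$ and $\xi=(R^{n+3/2})^2/E[\bar{\mathbf u}^{n+3/2}]$, satisfy the following equations. (a) In $\Omega$: $\frac{1}{\Delta t}\left(\frac32\tilde{\mathbf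 u}^{n+1}-2\mathbf u^n+\frac12\mathbf u^{n-1}\right)+g(\xi)\mathbf N(\mathbf u^*)+\nabla p^{n+1}+\nu\nabla\times\nabla\times\mathbf u^*=0$ and $\nabla\cdot\tilde{\mathbf u}^{n+1}=0$; on $\partial\Omega_d$: $\mathbf n\cdot\tilde{\mathbf u}^{n+1}=0$; on $\partial\Omega_o$: $$\frac{\nu D_0}{\Delta t}\left(\tfrac32\tilde{\mathbf u}^{n+1}-2\mathbf u^n+\tfrac12\mathbf u^{n-1}\right)\cdot\mathbf n-p^{n+1}+g(\xi)\left[\nu\,\mathbf n\cdot\nabla\mathbf u^*\cdot\mathbf n-\mathbf H(\mathbf n,\mathbf u^*)\cdot\mathbf n-\nu\nabla\cdot\mathbf u^*\right]=0 .$$ (b) In $\Omega$: $\frac{3}{2\Delta t}(\mathbf u^{n+1}-\tilde{\mathbf u}^{n+1})-\nu\nabla^2\mathbf u^{n+1}=\nu\nabla\times\nabla\times\mathbf u^*$; on $\partial\Omega_d$: $\mathbf u^{n+1}=0$; on $\partial\Omega_o$: $$\frac{\nu D_0}{\Delta t}\left(\tfrac32\mathbf u^{n+1}-2\mathbf u^n+\tfrac12\mathbf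 u^{n-1}\right)-p^{n+1}\mathbf n+\nu\,\mathbf n\cdot\nabla\mathbf u^{n+1}-g(\xi)\mathbf H(\mathbf n,\mathbf u^*)=0 .$$ (c) For all test functions $q$, $$\int_\Omega\nabla p_1\cdot\nabla q\,d\Omega+\frac1{\nu D_0}\int_{\partial\Omega_o}p_1q\,dA=\int_\Omega\frac{\hat{\mathbf u}}{\Delta t}\cdot\nabla q\,d\Omega-\nu\int_{\partial\Omega}\mathbf n\times\boldsymbol\omega^*\cdot\nabla q\,dA-\int_{\partial\Omega_o}\frac{\hat{\mathbf u}}{\Delta t}\cdot\mathbf n\,q\,dA,$$ $$\int_\Omega\nabla p_2\cdot\nabla q\,d\Omega+\frac1{\nu D_0}\int_{\partial\Omega_o}p_2q\,dA=-\int_\Omega\mathbf N(\mathbf u^*)\cdot\nabla q\,d\Omega-\frac1{\nu D_0}\int_{\partial\Omega_o}\left[-\nu\mathbf n\cdot\nabla\mathbf u^*\cdot\mathbf n+\mathbf H(\mathbf n,\mathbf u^*)\cdot\mathbf n+\nu\nabla\cdot\mathbf u^*\right]q\,dA .$$ (d) $\mathbf u_1=\mathbf u_2=0$ on $\partial\Omega_d$,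 and for all test functions $\varphi$ that vanish on $\partial\Omega_d$, with $a(\mathbf v,\varphi)=\int_\Omega\nabla\varphi\cdot\nabla\mathbf v\,d\Omega+\frac{3}{2\nu\Delta t}\int_\Omega\mathbf v\varphi\,d\Omega+\frac{3D_0}{2\Delta t}\int_{\partial\Omega_o}\mathbf v\varphi\,dA$, $$a(\mathbf u_1,\varphi)=\frac1\nu\int_\Omega\left(\frac{\hat{\mathbf u}}{\Delta t}-\nabla p_1\right)\varphi\,d\Omega+\int_{\partial\Omega_o}\left[\frac{D_0}{\Delta t}\hat{\mathbf u}+\frac1\nu p_1\mathbf n\right]\varphi\,dA,$$ $$a(\mathbf u_2,\varphi)=-\frac1\nu\int_\Omega\left[\nabla p_2+\mathbf N(\mathbf u^*)\right]\varphi\,d\Omega+\frac1\nu\int_{\partial\Omega_o}\left[p_2\mathbf n+\mathbf H(\mathbf n,\mathbf u^*)\right]\varphi\,dA .$$ (e) With $D\mathbf u=\frac1{\Delta t}\left(\frac32\mathbf u^{n+1}-2\mathbf u^n+\frac12\mathbf u^{n-1}\right)$, $$\begin{aligned}&\left(\tfrac32R^{n+1}+R^n-\tfrac12R^{n-1}\right)\frac{\frac32R^{n+1}-2R^n+\frac12R^{n-1}}{\Delta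 t}=\int_\Omega\mathbf u^{n+1}\cdot D\mathbf u\,d\Omega+\nu D_0\int_{\partial\Omega_o}\mathbf u^{n+1}\cdot D\mathbf u\,dA\\&\quad+\xi\left[-\nu\int_\Omega\|\nabla\bar{\mathbf u}^{n+1}\|^2d\Omega-\int_{\partial\Omega_o}\left(\tfrac12(\mathbf n\cdot\bar{\mathbf u}^{n+1})|\bar{\mathbf u}^{n+1}|^2-\mathbf H(\mathbf n,\bar{\mathbf u}^{n+1})\cdot\bar{\mathbf u}^{n+1}\right)dA\right]\\&\quad-\int_\Omega\left[-\nabla p^{n+1}+\nu\nabla^2\mathbf u^{n+1}-g(\xi)\mathbf N(\mathbf u^*)\right]\cdot\mathbf u^{n+1}d\Omega-\int_{\partial\Omega_o}\left[p^{n+1}\mathbf n-\nu\mathbf n\cdot\nabla\mathbf u^{n+1}+g(\xi)\mathbf H(\mathbf n,\mathbf u^*)\right]\cdot\mathbf u^{n+1}dA .\end{aligned}$$ Here the velocity fields are $C^2$ in $\Omega$ and continuous on $\overline\Omega$, with gradients that are square integrable and have square integrable boundary values almost everywhere; the pressure fields are $C^1$ in $\Omega$ and continuous on $\overline\Omega$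 with square integrable gradients; $\tilde{\mathbf u}^{n+1}$ is $C^1$ in $\Omega$ with boundary values almost everywhere; the test functions are $C^1$; and boundary conditions hold almost everywhere. It is assumed that $E[\bar{\mathbf u}^{n+3/2}]>0$ (for instance, $C_0>0$). Theorem. Put $\mathcal D=\nu\int_\Omega\|\nabla\bar{\mathbf u}^{n+1}\|^2d\Omega+\int_{\partial\Omega_o}\frac12|\bar{\mathbf u}^{n+1}|^2\,|\mathbf n\cdot\bar{\mathbf u}^{n+1}|\,dA$. (1) For the limiting scheme, in which $\Theta_0$ is the sharp step, $\xi\ge0$ and $$\left(R^{n+3/2}\right)^2-\left(R^{n+1/2}\right)^2=-\xi\Delta t\,\mathcal D\le0 .$$ (2) For every $\delta>0$, the scheme with the smoothed step satisfies $\xi\ge0$ and $\left(R^{n+3/2}\right)^2-\left(R^{n+1/2}\right)^2\le0$. (3) The identity in (1) holds in the limit $\delta\to0$ of the smoothed schemes: if $\delta_k>0$, $\delta_k\to0$, and for each $k$ a step of the scheme with $\delta=\delta_k$ is given such that $|R^{n+1/2}|$ and $\int_{\partial\Omega_o}|\mathbf u^n|^2dA$ are bounded and $E[\bar{\mathbf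 u}^{n+3/2}]$ is bounded below by a positive constant, uniformly in $k$ (for instance, if the data at levels $n-1$ and $n$ are fixed and $C_0>0$), then $\left(R^{n+3/2}\right)^2-\left(R^{n+1/2}\right)^2+\xi\Delta t\,\mathcal D\to0$ as $k\to\infty$. There is no restriction on $\Delta t>0$: the scheme is unconditionally energy stable. -/

import Mathlib

open MeasureTheory Set Filter Topology
open scoped InnerProductSpace ContDiff

noncomputable section

namespace OpenFlow

/-! ### Vector calculus in Euclidean space -/

/-- Euclidean space of dimension `d`. -/
abbrev E (d : ℕ) : Type := EuclideanSpace ℝ (Fin d)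

/-- The partial derivative `∂ᵢ f` of a scalar function. -/
def pderiv {d : ℕ} (i : Fin d) (f : E d → ℝ) (x : E d) : ℝ :=
  fderiv ℝ f x (EuclideanSpace.single i 1)

/-- The velocity gradient `(∇v) i j = ∂ᵢ vⱼ`. -/
def vgrad {d : ℕ} (v : E d → E d) (x : E d) : Fin d → Fin d → ℝ :=
  fun i j => pderiv i (fun y => v y j) x

/-- The contraction `a · G`, with `j`-th component `∑ᵢ aᵢ Gᵢⱼ`; so `a · ∇v` for `G = ∇v`. -/
def ndot {d : ℕ} (a : E d) (G : Fin d → Fin d → ℝ) : E d :=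
  WithLp.toLp 2 fun j => ∑ i, a i * G i j

/-- The convection term `N(v) = v · ∇v`. -/
def convection {d : ℕ} (v : E d → E d) (x : E d) : E d := ndot (v x) (vgrad v x)

/-- The trace of a gradient; the divergence of `v` for `G = ∇v`. -/
def divOf {d : ℕ} (G : Fin d → Fin d → ℝ) : ℝ := ∑ i, G i i

/-- `‖G‖² = ∑ᵢⱼ Gᵢⱼ²`. -/
def gradSq {d : ℕ} (G : Fin d → Fin d → ℝ) : ℝ := ∑ i, ∑ j, G i j ^ 2

/-- The antisymmetric vorticity tensor `Wᵢⱼ = ∂ᵢ vⱼ - ∂ⱼ vᵢ`, which encodes `∇ × v`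
in two dimensions (`ω = W₁₂`) and in three (`ω = (W₂₃, W₃₁, W₁₂)`). -/
def vorticity {d : ℕ} (G : Fin d → Fin d → ℝ) (i j : Fin d) : ℝ := G i j - G j i

/-- `∇ × ∇ × v`, with `i`-th component `∑ⱼ ∂ⱼ (∂ᵢ vⱼ - ∂ⱼ vᵢ)`; this is the usual iterated curl
in dimensions two and three. -/
def curlCurl {d : ℕ} (v : E d → E d) (x : E d) : E d :=
  WithLp.toLp 2 fun i => ∑ j, pderiv j (fun y => vorticity (vgrad v y) i j) x

/-- `n × (∇ × v)` in terms of `G = ∇v`, with `i`-th component `∑ⱼ nⱼ (∂ᵢ vⱼ - ∂ⱼ vᵢ)`; this is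
the usual cross product in dimensions two and three. -/
def crossVorticity {d : ℕ} (n : E d) (G : Fin d → Fin d → ℝ) : E d :=
  WithLp.toLp 2 fun i => ∑ j, n j * vorticity G i j

/-! ### The flow domain -/

/-- Surface measure, on subsets of the boundary of a domain in `E d`. -/
def surf (d : ℕ) : Measure (E d) := Measure.euclideanHausdorffMeasure (d - 1)

/-- `m` is the outward unit normal of `Ω` at `x`: near `x`, up to cones of arbitrarily small
opening around the tangent plane, `Ω` is the half space `⟪y - x, m⟫ < 0`. -/
def IsOutwardUnitNormal {d : ℕ} (Ω : Set (E d)) (x m : E d) : Prop :=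
  ‖m‖ = 1 ∧ ∀ ε > 0, ∀ᶠ y in 𝓝 x,
    (⟪y - x, m⟫_ℝ < -(ε * ‖y - x‖) → y ∈ Ω) ∧ (ε * ‖y - x‖ < ⟪y - x, m⟫_ℝ → y ∉ Ω)

/-- A bounded domain whose boundary has finite area and almost everywhere an outward unit normal,
and is divided into a Dirichlet part and an open part that do not overlap. Either part may be
empty. -/
structure FlowDomain (d : ℕ) where
  Ω : Set (E d)
  /-- Dirichlet boundary -/
  Γd : Set (E d)
  /-- open boundary -/
  Γo : Set (E d)
  /-- outward unit normal field -/
  n : E d → E d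
  isOpen : IsOpen Ω
  isConnected : IsConnected Ω
  isBounded : Bornology.IsBounded Ω
  area_lt_top : surf d (frontier Ω) < ⊤
  measurableSet_Γd : MeasurableSet Γd
  measurableSet_Γo : MeasurableSet Γo
  union_eq : Γd ∪ Γo = frontier Ω
  inter_null : surf d (Γd ∩ Γo) = 0
  measurable_n : Measurable n
  normal : ∀ᵐ x ∂(surf d).restrict (frontier Ω), IsOutwardUnitNormal Ω x (n x)

/-- `f` has a limit from inside `Ω` at almost every boundary point. The boundary values are then
those of `extendFrom Ω f`. -/
def HasBoundaryValues {d : ℕ} {F : Type*} [TopologicalSpace F] (Ω : Set (E d)) (f : E d → F) :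
    Prop :=
  ∀ᵐ x ∂(surf d).restrict (frontier Ω), ∃ L, Tendsto f (𝓝[Ω] x) (𝓝 L)

/-- Regularity of a velocity field: continuous up to the boundary, `C²` inside, with a square
integrable gradient that has square integrable boundary values. -/
structure IsVelocity {d : ℕ} (Ω : Set (E d)) (v : E d → E d) : Prop where
  continuousOn : ContinuousOn v (closure Ω)
  contDiffOn : ContDiffOn ℝ 2 v Ω
  memLp : MemLp (vgrad v) 2 (volume.restrict Ω)
  hasBoundaryValues : HasBoundaryValues Ω (vgrad v)
  memLp_boundary : MemLp (extendFrom Ω (vgrad v)) 2 ((surf d).restrict (frontier Ω))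

/-- Regularity of a pressure field: continuous up to the boundary, `C¹` inside, with a square
integrable gradient. -/
structure IsPressure {d : ℕ} (Ω : Set (E d)) (p : E d → ℝ) : Prop where
  continuousOn : ContinuousOn p (closure Ω)
  contDiffOn : ContDiffOn ℝ 1 p Ω
  memLp : MemLp (gradient p) 2 (volume.restrict Ω)

/-! ### Ingredients of the scheme -/

/-- Viscosity `ν`, inverse outflow velocity scale `D0`, energy constant `C0`, time step `Δt`. -/
structure Params where
  ν : ℝ
  D0 : ℝ
  C0 : ℝ
  Δt : ℝ
  ν_pos : 0 < ν
  D0_pos : 0 < D0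
  Δt_pos : 0 < Δt

/-- The smoothed step `s ↦ (1 - tanh (s / (U₀ δ))) / 2`, applied to `s = n · u`. -/
def smoothStep (U0 δ s : ℝ) : ℝ := (1 - Real.tanh (s / (U0 * δ))) / 2

/-- The sharp step: one for `s < 0`, zero for `s > 0`, with any value at `s = 0`. -/
def IsSharpStep (Θ : ℝ → ℝ) : Prop := (∀ s < 0, Θ s = 1) ∧ (∀ s > 0, Θ s = 0)

/-- `H(n, u) = [½ |u|² n + ½ (n · u) u] Θ(n · u)`. -/
def H {d : ℕ} (Θ : ℝ → ℝ) (n u : E d) : E d :=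
  Θ ⟪n, u⟫_ℝ • ((1 / 2 * ‖u‖ ^ 2) • n + (1 / 2 * ⟪n, u⟫_ℝ) • u)

/-- The function `g(χ)`, equal to `χ` for `χ ≤ 1` and to `1` for `χ > 1`. -/
def g (χ : ℝ) : ℝ := if χ ≤ 1 then χ else 1

/-- The biased modified energy `E[v]`. -/
def energy {d : ℕ} (D : FlowDomain d) (P : Params) (v : E d → E d) : ℝ :=
  (∫ x in D.Ω, 1 / 2 * ‖v x‖ ^ 2) +
    P.ν * P.D0 * (∫ x in D.Γo, 1 / 2 * ‖v x‖ ^ 2 ∂surf d) + P.C0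

/-- The backward difference `(3/2 a - 2 b + 1/2 c) / Δt`. -/
def bdf {d : ℕ} (P : Params) (a b c : E d) : E d :=
  (1 / P.Δt) • ((3 / 2 : ℝ) • a - (2 : ℝ) • b + (1 / 2 : ℝ) • c)

/-- All the quantities of one time step, from level `n` to level `n + 1`. -/
structure StepFields (d : ℕ) where
  /-- `u` at level `n - 1` -/
  uPrev : E d → E d
  /-- `u` at level `n` -/
  uCur : E d → E d
  /-- `u` at level `n + 1` -/
  uNext : E d → E d
  /-- the auxiliary velocity at level `n + 1` -/
  uTilde : E d → E d
  /-- `p` at level `n + 1` -/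
  p : E d → ℝ
  p1 : E d → ℝ
  p2 : E d → ℝ
  u1 : E d → E d
  u2 : E d → E d
  /-- `R` at level `n - 1` -/
  RPrev : ℝ
  /-- `R` at level `n` -/
  RCur : ℝ
  /-- `R` at level `n + 1` -/
  RNext : ℝ

namespace StepFields

variable {d : ℕ} (S : StepFields d)

/-- The explicit approximation `2 uⁿ - uⁿ⁻¹`. -/
def uStar (x : E d) : E d := (2 : ℝ) • S.uCur x - S.uPrev x

/-- `2 uⁿ - ½ uⁿ⁻¹`. -/
def uHat (x : E d) : E d := (2 : ℝ) • S.uCur x - (1 / 2 : ℝ) • S.uPrev x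

/-- `ū` at level `n + 1`, namely `u₁ + u₂`. -/
def uBar (x : E d) : E d := S.u1 x + S.u2 x

/-- `ū` at level `n + 3/2`. -/
def uBar32 (x : E d) : E d := (3 / 2 : ℝ) • S.uBar x - (1 / 2 : ℝ) • S.uCur x

/-- `R` at level `n + 3/2`. -/
def R32 : ℝ := 3 / 2 * S.RNext - 1 / 2 * S.RCur

/-- `R` at level `n + 1/2`. -/
def R12 : ℝ := 3 / 2 * S.RCur - 1 / 2 * S.RPrev

/-- `ξ = (Rⁿ⁺³ᐟ²)² / E[ūⁿ⁺³ᐟ²]`. -/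
def ξ (D : FlowDomain d) (P : Params) : ℝ := S.R32 ^ 2 / energy D P S.uBar32

/-- The boundary values of the gradient of a velocity field. -/
abbrev bgrad (D : FlowDomain d) (v : E d → E d) : E d → Fin d → Fin d → ℝ :=
  extendFrom D.Ω (vgrad v)

end StepFields

open StepFields

/-! ### The scheme -/

section Scheme

variable {d : ℕ} (D : FlowDomain d) (P : Params) (Θ : ℝ → ℝ)
  (f w fb : E d → E d) (p0 : E d → ℝ) (S : StepFields d)

/-- Equations for the pressure and the auxiliary velocity, with `g(ξ)` evaluated at
`ξ = (Rⁿ⁺³ᐟ²)² / E[ūⁿ⁺³ᐟ²]`. -/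
structure PressureStep : Prop where
  momentum : ∀ x ∈ D.Ω,
    bdf P (S.uTilde x) (S.uCur x) (S.uPrev x) + g (S.ξ D P) • convection S.uStar x
      + gradient S.p x + P.ν • curlCurl S.uStar x = f x
  divergence : ∀ x ∈ D.Ω, divOf (vgrad S.uTilde x) = 0
  dirichlet : ∀ᵐ x ∂(surf d).restrict D.Γd,
    ⟪D.n x, extendFrom D.Ω S.uTilde x⟫_ℝ = ⟪D.n x, w x⟫_ℝ
  openBoundary : ∀ᵐ x ∂(surf d).restrict D.Γo,
    P.ν * P.D0 * ⟪bdf P (extendFrom D.Ω S.uTilde x) (S.uCur x) (S.uPrev x), D.n x⟫_ℝ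
      - (S.p x - p0 x)
      + g (S.ξ D P) * P.ν * ⟪ndot (D.n x) (bgrad D S.uStar x), D.n x⟫_ℝ
      - g (S.ξ D P) * ⟪H Θ (D.n x) (S.uStar x), D.n x⟫_ℝ
      - g (S.ξ D P) * P.ν * divOf (bgrad D S.uStar x) = ⟪fb x, D.n x⟫_ℝ

/-- Equations for the velocity. -/
structure VelocityStep : Prop where
  momentum : ∀ x ∈ D.Ω,
    (1 / P.Δt) • ((3 / 2 : ℝ) • S.uNext x - (3 / 2 : ℝ) • S.uTilde x)
      - P.ν • Laplacian.laplacian S.uNext x = P.ν • curlCurl S.uStar x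
  dirichlet : ∀ᵐ x ∂(surf d).restrict D.Γd, S.uNext x = w x
  openBoundary : ∀ᵐ x ∂(surf d).restrict D.Γo,
    (P.ν * P.D0) • bdf P (S.uNext x) (S.uCur x) (S.uPrev x)
      - (S.p x - p0 x) • D.n x + P.ν • ndot (D.n x) (bgrad D S.uNext x)
      - g (S.ξ D P) • H Θ (D.n x) (S.uStar x) = fb x

/-- The definition of the pressure components `p₁` and `p₂` by weak problems. -/
structure PressureComponents : Prop where
  p1_weak : ∀ q : E d → ℝ, ContDiff ℝ 1 q →
    (∫ x in D.Ω, ⟪gradient S.p1 x, gradient q x⟫_ℝ)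
        + 1 / (P.ν * P.D0) * (∫ x in D.Γo, S.p1 x * q x ∂surf d)
      = (∫ x in D.Ω, ⟪f x + (1 / P.Δt) • S.uHat x, gradient q x⟫_ℝ)
        - P.ν * (∫ x in frontier D.Ω,
            ⟪crossVorticity (D.n x) (bgrad D S.uStar x), gradient q x⟫_ℝ ∂surf d)
        - (3 / 2) / P.Δt * (∫ x in D.Γd, ⟪D.n x, w x⟫_ℝ * q x ∂surf d)
        - (∫ x in D.Γo, (1 / P.Δt * ⟪S.uHat x, D.n x⟫_ℝ
            + 1 / (P.ν * P.D0) * (-p0 x + ⟪fb x, D.n x⟫_ℝ)) * q x ∂surf d)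
  p2_weak : ∀ q : E d → ℝ, ContDiff ℝ 1 q →
    (∫ x in D.Ω, ⟪gradient S.p2 x, gradient q x⟫_ℝ)
        + 1 / (P.ν * P.D0) * (∫ x in D.Γo, S.p2 x * q x ∂surf d)
      = -(∫ x in D.Ω, ⟪convection S.uStar x, gradient q x⟫_ℝ)
        - 1 / (P.ν * P.D0) * (∫ x in D.Γo,
            (-(P.ν * ⟪ndot (D.n x) (bgrad D S.uStar x), D.n x⟫_ℝ)
              + ⟪H Θ (D.n x) (S.uStar x), D.n x⟫_ℝ
              + P.ν * divOf (bgrad D S.uStar x)) * q x ∂surf d)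

/-- The definition of the velocity components `u₁` and `u₂` by weak problems, with scalar test
functions that vanish on the Dirichlet boundary. -/
structure VelocityComponents : Prop where
  u1_weak : ∀ φ : E d → ℝ, ContDiff ℝ 1 φ → (∀ x ∈ D.Γd, φ x = 0) →
    (∫ x in D.Ω, ndot (gradient φ x) (vgrad S.u1 x))
        + ((3 / 2) / (P.ν * P.Δt)) • (∫ x in D.Ω, φ x • S.u1 x)
        + ((3 / 2) * P.D0 / P.Δt) • (∫ x in D.Γo, φ x • S.u1 x ∂surf d)
      = (1 / P.ν) • (∫ x in D.Ω, φ x • (f x + (1 / P.Δt) • S.uHat x - gradient S.p1 x))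
        + (∫ x in D.Γo, φ x • ((P.D0 / P.Δt) • S.uHat x
            + (1 / P.ν) • (fb x + (S.p1 x - p0 x) • D.n x)) ∂surf d)
  u1_dirichlet : ∀ᵐ x ∂(surf d).restrict D.Γd, S.u1 x = w x
  u2_weak : ∀ φ : E d → ℝ, ContDiff ℝ 1 φ → (∀ x ∈ D.Γd, φ x = 0) →
    (∫ x in D.Ω, ndot (gradient φ x) (vgrad S.u2 x))
        + ((3 / 2) / (P.ν * P.Δt)) • (∫ x in D.Ω, φ x • S.u2 x)
        + ((3 / 2) * P.D0 / P.Δt) • (∫ x in D.Γo, φ x • S.u2 x ∂surf d)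
      = -((1 / P.ν) • (∫ x in D.Ω, φ x • (gradient S.p2 x + convection S.uStar x)))
        + (1 / P.ν) • (∫ x in D.Γo,
            φ x • (S.p2 x • D.n x + H Θ (D.n x) (S.uStar x)) ∂surf d)
  u2_dirichlet : ∀ᵐ x ∂(surf d).restrict D.Γd, S.u2 x = 0

/-- The equation for the scalar auxiliary variable. -/
def AuxiliaryEquation : Prop :=
  (3 / 2 * S.RNext + S.RCur - 1 / 2 * S.RPrev)
      * ((3 / 2 * S.RNext - 2 * S.RCur + 1 / 2 * S.RPrev) / P.Δt)
    = (∫ x in D.Ω, ⟪S.uNext x, bdf P (S.uNext x) (S.uCur x) (S.uPrev x)⟫_ℝ)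
      + P.ν * P.D0 * (∫ x in D.Γo,
          ⟪S.uNext x, bdf P (S.uNext x) (S.uCur x) (S.uPrev x)⟫_ℝ ∂surf d)
      + S.ξ D P * (-(P.ν * ∫ x in D.Ω, gradSq (vgrad S.uBar x))
          - ∫ x in D.Γo, (1 / 2 * ⟪D.n x, S.uBar x⟫_ℝ * ‖S.uBar x‖ ^ 2
              - ⟪H Θ (D.n x) (S.uBar x), S.uBar x⟫_ℝ) ∂surf d)
      - (∫ x in D.Ω, ⟪-gradient S.p x + P.ν • Laplacian.laplacian S.uNext x + f x
          - g (S.ξ D P) • convection S.uStar x, S.uNext x⟫_ℝ)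
      - (∫ x in D.Γo, ⟪(S.p x - p0 x) • D.n x - P.ν • ndot (D.n x) (bgrad D S.uNext x)
          + g (S.ξ D P) • H Θ (D.n x) (S.uStar x) + fb x, S.uNext x⟫_ℝ ∂surf d)
      + (∫ x in D.Γd, ⟪-((S.p1 x + S.ξ D P * S.p2 x) • D.n x)
          + P.ν • ndot (D.n x) (bgrad D S.u1 x + S.ξ D P • bgrad D S.u2 x)
          - (1 / 2 * ⟪D.n x, w x⟫_ℝ) • w x, w x⟫_ℝ ∂surf d)
      + (∫ x in D.Ω, ⟪f x, S.u1 x + S.ξ D P • S.u2 x⟫_ℝ)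
      + (∫ x in D.Γo, ⟪fb x - p0 x • D.n x, S.u1 x + S.ξ D P • S.u2 x⟫_ℝ ∂surf d)
      + (1 - S.ξ D P) *
        (|∫ x in D.Ω, ⟪f x, S.u1 x⟫_ℝ| + |∫ x in D.Ω, ⟪f x, S.u2 x⟫_ℝ|
          + |∫ x in D.Γo, ⟪fb x, S.u1 x⟫_ℝ ∂surf d|
          + |∫ x in D.Γo, ⟪fb x, S.u2 x⟫_ℝ ∂surf d|
          + |∫ x in D.Γo, p0 x * ⟪D.n x, S.u1 x⟫_ℝ ∂surf d|
          + |∫ x in D.Γo, p0 x * ⟪D.n x, S.u2 x⟫_ℝ ∂surf d|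
          + |∫ x in D.Γd, ⟪-(S.p1 x • D.n x) + P.ν • ndot (D.n x) (bgrad D S.u1 x)
              - (1 / 2 * ⟪D.n x, w x⟫_ℝ) • w x, w x⟫_ℝ ∂surf d|
          + |∫ x in D.Γd, ⟪-(S.p2 x • D.n x) + P.ν • ndot (D.n x) (bgrad D S.u2 x),
              w x⟫_ℝ ∂surf d|)

/-- `S` is a time step of the scheme, with step function `Θ` in the open boundary condition, body
force `f`, Dirichlet data `w`, boundary source `fb` and external pressure head `p0`. -/
structure IsSchemeStep : Prop where
  uPrev_reg : IsVelocity D.Ω S.uPrev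
  uCur_reg : IsVelocity D.Ω S.uCur
  uNext_reg : IsVelocity D.Ω S.uNext
  u1_reg : IsVelocity D.Ω S.u1
  u2_reg : IsVelocity D.Ω S.u2
  p_reg : IsPressure D.Ω S.p
  p1_reg : IsPressure D.Ω S.p1
  p2_reg : IsPressure D.Ω S.p2
  uTilde_reg : ContDiffOn ℝ 1 S.uTilde D.Ω
  uTilde_boundary : HasBoundaryValues D.Ω S.uTilde
  pressure : PressureStep D P Θ f w fb p0 S
  velocity : VelocityStep D P Θ w fb p0 S
  pressureComponents : PressureComponents D P Θ f w fb p0 S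
  velocityComponents : VelocityComponents D P Θ f w fb p0 S
  auxiliary : AuxiliaryEquation D P Θ f w fb p0 S

/-- The dissipation `ν ∫_Ω ‖∇ū‖² + ∫_{∂Ω_o} ½ |ū|² |n · ū|` of the step, where `ū` is taken at
level `n + 1`. -/
def dissipation : ℝ :=
  P.ν * (∫ x in D.Ω, gradSq (vgrad S.uBar x))
    + ∫ x in D.Γo, 1 / 2 * ‖S.uBar x‖ ^ 2 * |⟪D.n x, S.uBar x⟫_ℝ| ∂surf d

end Scheme

end OpenFlow

end

namespace OpenFlow

open StepFields

variable {d : ℕ}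

/-! Adding the two momentum equations eliminates the auxiliary velocity and gives the momentum
balance for the backward difference of the velocity. With the open boundary condition it cancels
every volume and boundary work term of the auxiliary equation except the one multiplied by `ξ`. The
left side of that equation, times `Δt`, is a difference of squares, which gives `energy_balance` for
any step function.

Everything then depends on the boundary flux integrand. With `s = n · ū`, it is `½|ū|² |s|` for the
sharp step (`boundary_flux_sharp`) and `½|ū|² s tanh(s / (U₀δ))` for the smoothed one
(`boundary_flux_smooth`). Both are nonnegative, so (1) and (2) follow.

For (3), `|s| - s tanh(s/ε)` lies between `0` and `ε`, so the defect is at most `ξ Δt (U₀δ/2) ∫|ū|²`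
over the open boundary (`smooth_defect`). A uniform bound on `ξ ∫|ū|²` is still needed. It comes
from the definition of `ξ`: `ξ E[ū³²]` is `R32²`, which is at most `R12²` by (2), and `E` contains
the boundary norm of `ū³²` (`xi_mul_integral_le`). -/

theorem inner_H_self (Θ : ℝ → ℝ) (n u : E d) :
    ⟪H Θ n u, u⟫_ℝ = Θ ⟪n, u⟫_ℝ * (⟪n, u⟫_ℝ * ‖u‖ ^ 2) := by
  simp only [H, inner_smul_left, inner_add_left, real_inner_self_eq_norm_sq, conj_trivial]
  ring

theorem gradSq_nonneg (G : Fin d → Fin d → ℝ) : 0 ≤ gradSq G :=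
  Finset.sum_nonneg fun _ _ => Finset.sum_nonneg fun _ _ => sq_nonneg _

/-! ### Estimates for `tanh` and the pointwise boundary flux. -/

theorem tanh_eq_one_sub (x : ℝ) : Real.tanh x = 1 - 2 / (Real.exp (2 * x) + 1) := by
  have h : Real.exp (2 * x) = Real.exp x * Real.exp x := by rw [← Real.exp_add]; ring_nf
  have h2 : Real.exp x * Real.exp (-x) = 1 := by rw [← Real.exp_add]; simp
  have h3 := Real.exp_pos x
  have h4 := Real.exp_pos (-x)
  rw [Real.tanh_eq_sinh_div_cosh, Real.sinh_eq, Real.cosh_eq, h]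
  field_simp
  nlinarith

theorem mul_tanh_nonneg {ε : ℝ} (hε : 0 < ε) (s : ℝ) : 0 ≤ s * Real.tanh (s / ε) := by
  rw [tanh_eq_one_sub]
  have h := Real.add_one_le_exp (2 * (s / ε))
  have hp := Real.exp_pos (2 * (s / ε))
  have e : 1 - 2 / (Real.exp (2 * (s / ε)) + 1)
      = (Real.exp (2 * (s / ε)) - 1) / (Real.exp (2 * (s / ε)) + 1) := by
    field_simp; ring
  rw [e, ← mul_div_assoc]
  refine div_nonneg ?_ (by positivity)
  rcases le_total 0 s with hs | hs
  · refine mul_nonneg hs (sub_nonneg.2 (Real.one_le_exp (by positivity)))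
  · refine mul_nonneg_of_nonpos_of_nonpos hs (sub_nonpos.2 (Real.exp_le_one_iff.2 ?_))
    have : s / ε ≤ 0 := div_nonpos_of_nonpos_of_nonneg hs hε.le
    linarith

/-- For `t ≥ 0` the difference equals `2t / (exp(2t/ε) + 1)`, and `exp x ≥ 1 + x` bounds it by `ε`;
evenness covers `s < 0`. Uniformity in `s` gives a rate of order `δ` without dominated convergence.
-/
theorem abs_sub_mul_tanh_le {ε : ℝ} (hε : 0 < ε) (s : ℝ) :
    |s| - s * Real.tanh (s / ε) ≤ ε := by
  have main : ∀ t : ℝ, 0 ≤ t → t - t * Real.tanh (t / ε) ≤ ε := by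
    intro t ht
    rw [tanh_eq_one_sub]
    have h := Real.add_one_le_exp (2 * (t / ε))
    have e : t - t * (1 - 2 / (Real.exp (2 * (t / ε)) + 1))
        = 2 * t / (Real.exp (2 * (t / ε)) + 1) := by ring
    have h2 : ε * (2 * (t / ε)) = 2 * t := by field_simp
    rw [e, div_le_iff₀ (by positivity)]
    nlinarith
  rcases le_total 0 s with hs | hs
  · rw [abs_of_nonneg hs]; exact main s hs
  · have := main (-s) (by linarith)
    rw [neg_div, Real.tanh_neg] at this
    rw [abs_of_nonpos hs]; linarith

theorem mul_tanh_le_abs (ε s : ℝ) : |s * Real.tanh (s / ε)| ≤ |s| := by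
  rw [abs_mul]
  exact mul_le_of_le_one_right (abs_nonneg _) (Real.abs_tanh_lt_one _).le

/-- The integrand of the boundary flux of the energy through the open boundary. -/
theorem boundary_flux_sharp {Θ : ℝ → ℝ} (hΘ : IsSharpStep Θ) (n u : E d) :
    1 / 2 * ⟪n, u⟫_ℝ * ‖u‖ ^ 2 - ⟪H Θ n u, u⟫_ℝ = 1 / 2 * ‖u‖ ^ 2 * |⟪n, u⟫_ℝ| := by
  rw [inner_H_self]
  rcases lt_trichotomy ⟪n, u⟫_ℝ 0 with h | h | h
  · rw [hΘ.1 _ h, abs_of_neg h]; ring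
  · rw [h]; simp
  · rw [hΘ.2 _ h, abs_of_pos h]; ring

theorem boundary_flux_smooth (U0 δ : ℝ) (n u : E d) :
    1 / 2 * ⟪n, u⟫_ℝ * ‖u‖ ^ 2 - ⟪H (smoothStep U0 δ) n u, u⟫_ℝ
      = 1 / 2 * ‖u‖ ^ 2 * (⟪n, u⟫_ℝ * Real.tanh (⟪n, u⟫_ℝ / (U0 * δ))) := by
  rw [inner_H_self, smoothStep]; ring

/-! ### Energy balance of one step. -/

section Step

variable {D : FlowDomain d} {P : Params} {Θ : ℝ → ℝ} {S : StepFields d}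

theorem FlowDomain.Γo_subset (D : FlowDomain d) : D.Γo ⊆ frontier D.Ω :=
  D.union_eq ▸ subset_union_right

/-- In the sum of the two momentum equations both `uTilde` and the explicit curl-curl term cancel.
-/
theorem IsSchemeStep.momentum (hS : IsSchemeStep D P Θ 0 0 0 0 S) {x : E d} (hx : x ∈ D.Ω) :
    bdf P (S.uNext x) (S.uCur x) (S.uPrev x)
      = -gradient S.p x + P.ν • Laplacian.laplacian S.uNext x
        - g (S.ξ D P) • convection S.uStar x := by
  have h1 := hS.pressure.momentum x hx
  have h2 := hS.velocity.momentum x hx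
  simp only [Pi.zero_apply] at h1
  have e : bdf P (S.uNext x) (S.uCur x) (S.uPrev x) = bdf P (S.uTilde x) (S.uCur x) (S.uPrev x)
      + (1 / P.Δt) • ((3 / 2 : ℝ) • S.uNext x - (3 / 2 : ℝ) • S.uTilde x) := by
    simp only [bdf]; module
  rw [e, sub_eq_iff_eq_add.1 h2,
    show bdf P (S.uTilde x) (S.uCur x) (S.uPrev x) = -(g (S.ξ D P) • convection S.uStar x
      + gradient S.p x + P.ν • curlCurl S.uStar x) from
        eq_neg_of_add_eq_zero_left (by rw [← h1]; abel)]
  abel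

theorem IsSchemeStep.energy_balance (hS : IsSchemeStep D P Θ 0 0 0 0 S) :
    S.R32 ^ 2 - S.R12 ^ 2 = -(S.ξ D P * P.Δt * (P.ν * (∫ x in D.Ω, gradSq (vgrad S.uBar x))
      + ∫ x in D.Γo, (1 / 2 * ⟪D.n x, S.uBar x⟫_ℝ * ‖S.uBar x‖ ^ 2
              - ⟪H Θ (D.n x) (S.uBar x), S.uBar x⟫_ℝ) ∂surf d)) := by
  have hΩ : (∫ x in D.Ω, ⟪-gradient S.p x + P.ν • Laplacian.laplacian S.uNext x
        - g (S.ξ D P) • convection S.uStar x, S.uNext x⟫_ℝ)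
      = ∫ x in D.Ω, ⟪S.uNext x, bdf P (S.uNext x) (S.uCur x) (S.uPrev x)⟫_ℝ :=
    setIntegral_congr_fun D.isOpen.measurableSet fun x hx => by
      simp only [hS.momentum hx, real_inner_comm]
  have hΓ : (∫ x in D.Γo, ⟪S.p x • D.n x - P.ν • ndot (D.n x) (bgrad D S.uNext x)
        + g (S.ξ D P) • H Θ (D.n x) (S.uStar x), S.uNext x⟫_ℝ ∂surf d)
      = P.ν * P.D0 * ∫ x in D.Γo,
          ⟪S.uNext x, bdf P (S.uNext x) (S.uCur x) (S.uPrev x)⟫_ℝ ∂surf d := by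
    rw [← integral_const_mul]
    refine integral_congr_ae ?_
    filter_upwards [hS.velocity.openBoundary] with x hx
    simp only [Pi.zero_apply, sub_zero] at hx
    rw [← real_inner_smul_right, real_inner_comm]
    congr 1
    -- The difference of the two sides is, up to sign, the residual of the open boundary condition.
    rw [← sub_eq_zero, ← neg_eq_zero, ← hx]
    abel
  have h := hS.auxiliary
  simp only [AuxiliaryEquation, Pi.zero_apply, inner_zero_left, inner_zero_right, add_zero,
    sub_zero, integral_zero, abs_zero, mul_zero, zero_mul, zero_smul] at h
  rw [hΩ, hΓ] at h
  have hΔ := P.Δt_pos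
  -- The two factors are `R32 + R12` and `(R32 - R12) / Δt`.
  have e : S.R32 ^ 2 - S.R12 ^ 2 = P.Δt * ((3 / 2 * S.RNext + S.RCur - 1 / 2 * S.RPrev)
      * ((3 / 2 * S.RNext - 2 * S.RCur + 1 / 2 * S.RPrev) / P.Δt)) := by
    simp only [R32, R12]; field_simp; ring
  rw [e, h]
  ring

theorem xi_nonneg (hE : 0 < energy D P S.uBar32) : 0 ≤ S.ξ D P :=
  div_nonneg (sq_nonneg _) hE.le

theorem viscous_nonneg : 0 ≤ P.ν * ∫ x in D.Ω, gradSq (vgrad S.uBar x) :=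
  mul_nonneg P.ν_pos.le (integral_nonneg fun _ => gradSq_nonneg _)

theorem dissipation_nonneg : 0 ≤ dissipation D P S :=
  add_nonneg viscous_nonneg (integral_nonneg fun _ => by positivity)

theorem IsSchemeStep.sharp_identity (hΘ : IsSharpStep Θ) (hS : IsSchemeStep D P Θ 0 0 0 0 S) :
    S.R32 ^ 2 - S.R12 ^ 2 = -(S.ξ D P * P.Δt * dissipation D P S) := by
  rw [hS.energy_balance, dissipation]
  simp only [boundary_flux_sharp hΘ]

theorem IsSchemeStep.smooth_decay {U0 δ : ℝ} (hU0 : 0 < U0) (hδ : 0 < δ)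
    (hS : IsSchemeStep D P (smoothStep U0 δ) 0 0 0 0 S) (hE : 0 < energy D P S.uBar32) :
    S.R32 ^ 2 - S.R12 ^ 2 ≤ 0 := by
  rw [hS.energy_balance]
  simp only [boundary_flux_smooth]
  refine neg_nonpos.2 (mul_nonneg (mul_nonneg (xi_nonneg hE) P.Δt_pos.le)
    (add_nonneg viscous_nonneg (integral_nonneg fun x => ?_)))
  exact mul_nonneg (by positivity) (mul_tanh_nonneg (mul_pos hU0 hδ) _)

/-! ### Fields on the open boundary -/

theorem FlowDomain.isFiniteMeasure_Γo (D : FlowDomain d) :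
    IsFiniteMeasure ((surf d).restrict D.Γo) :=
  ⟨by
    rw [Measure.restrict_apply_univ]
    exact (measure_mono D.Γo_subset).trans_lt D.area_lt_top⟩

theorem memLp_top_of_continuousOn {v : E d → E d} (hv : ContinuousOn v (closure D.Ω)) :
    MemLp v ⊤ ((surf d).restrict D.Γo) := by
  have hc : IsCompact (closure D.Ω) := D.isBounded.isCompact_closure
  have hsub : D.Γo ⊆ closure D.Ω := D.Γo_subset.trans frontier_subset_closure
  obtain ⟨C, hC⟩ := hc.exists_bound_of_continuousOn hv
  have := D.isFiniteMeasure_Γo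
  refine MemLp.of_bound ((hv.mono hsub).aestronglyMeasurable D.measurableSet_Γo) C ?_
  filter_upwards [ae_restrict_mem D.measurableSet_Γo] with x hx using hC x (hsub hx)

theorem integrable_sq {v : E d → E d} (hv : ContinuousOn v (closure D.Ω)) :
    Integrable (fun x => ‖v x‖ ^ 2) ((surf d).restrict D.Γo) := by
  have := D.isFiniteMeasure_Γo
  exact ((memLp_top_of_continuousOn hv).mono_exponent le_top).integrable_norm_pow
    (p := 2) (by norm_num)

theorem FlowDomain.norm_n (D : FlowDomain d) : ∀ᵐ x ∂(surf d).restrict D.Γo, ‖D.n x‖ = 1 := by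
  filter_upwards [ae_restrict_of_ae_restrict_of_subset D.Γo_subset D.normal] with x hx using hx.1

/-- A measurable flux bounded by `½ |v|² |n · v|` is integrable on the open boundary. -/
theorem integrable_flux {v : E d → E d} (hv : ContinuousOn v (closure D.Ω)) {θ : ℝ → ℝ}
    (hθ : Measurable θ) (hle : ∀ s, |θ s| ≤ |s|) :
    Integrable (fun x => 1 / 2 * ‖v x‖ ^ 2 * θ ⟪D.n x, v x⟫_ℝ) ((surf d).restrict D.Γo) := by
  have hc : IsCompact (closure D.Ω) := D.isBounded.isCompact_closure
  have hsub : D.Γo ⊆ closure D.Ω := D.Γo_subset.trans frontier_subset_closure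
  obtain ⟨C, hC⟩ := hc.exists_bound_of_continuousOn hv
  have hm := (memLp_top_of_continuousOn hv).aestronglyMeasurable
  refine ((integrable_sq hv).const_mul (1 / 2)).mul_bdd (c := C)
    (hθ.comp_aemeasurable
      (D.measurable_n.aemeasurable.inner hm.aemeasurable)).aestronglyMeasurable ?_
  filter_upwards [ae_restrict_mem D.measurableSet_Γo, D.norm_n] with x hx hn
  refine (hle _).trans ((abs_real_inner_le_norm _ _).trans ?_)
  rw [hn, one_mul]
  exact hC x (hsub hx)

theorem IsSchemeStep.continuousOn_uBar (hS : IsSchemeStep D P Θ 0 0 0 0 S) :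
    ContinuousOn S.uBar (closure D.Ω) :=
  hS.u1_reg.continuousOn.add hS.u2_reg.continuousOn

theorem IsSchemeStep.continuousOn_uBar32 (hS : IsSchemeStep D P Θ 0 0 0 0 S) :
    ContinuousOn S.uBar32 (closure D.Ω) :=
  (hS.continuousOn_uBar.const_smul (3 / 2 : ℝ)).sub
    (hS.uCur_reg.continuousOn.const_smul (1 / 2 : ℝ))

theorem measurable_tanh : Measurable Real.tanh := by
  have : Real.tanh = fun x => Real.sinh x / Real.cosh x :=
    funext Real.tanh_eq_sinh_div_cosh
  rw [this]
  exact Real.measurable_sinh.div Real.measurable_cosh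

/-! ### Quantitative limit of the smoothed schemes. -/

theorem IsSchemeStep.smooth_defect {U0 δ : ℝ} (hU0 : 0 < U0) (hδ : 0 < δ)
    (hS : IsSchemeStep D P (smoothStep U0 δ) 0 0 0 0 S) (hE : 0 < energy D P S.uBar32) :
    |S.R32 ^ 2 - S.R12 ^ 2 + S.ξ D P * P.Δt * dissipation D P S|
      ≤ S.ξ D P * P.Δt * (U0 * δ / 2 * ∫ x in D.Γo, ‖S.uBar x‖ ^ 2 ∂surf d) := by
  have hε := mul_pos hU0 hδ
  have i1 := integrable_flux (D := D) hS.continuousOn_uBar measurable_norm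
    (fun s => by simp)
  have i2 := integrable_flux (D := D) hS.continuousOn_uBar
    (θ := fun s => s * Real.tanh (s / (U0 * δ)))
    (measurable_id.mul (measurable_tanh.comp (measurable_id.div_const _)))
    (fun s => mul_tanh_le_abs _ s)
  simp only [Real.norm_eq_abs] at i1
  have e : S.R32 ^ 2 - S.R12 ^ 2 + S.ξ D P * P.Δt * dissipation D P S
      = S.ξ D P * P.Δt * ∫ x in D.Γo, (1 / 2 * ‖S.uBar x‖ ^ 2 * |⟪D.n x, S.uBar x⟫_ℝ|
        - 1 / 2 * ‖S.uBar x‖ ^ 2 * (⟪D.n x, S.uBar x⟫_ℝ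
          * Real.tanh (⟪D.n x, S.uBar x⟫_ℝ / (U0 * δ)))) ∂surf d := by
    rw [integral_sub i1 i2, hS.energy_balance, dissipation]
    simp only [boundary_flux_smooth]
    ring
  have hξ := mul_nonneg (xi_nonneg hE) P.Δt_pos.le
  have hpos : ∀ s : ℝ, 0 ≤ |s| - s * Real.tanh (s / (U0 * δ)) := fun s =>
    sub_nonneg.2 ((le_abs_self _).trans (mul_tanh_le_abs _ s))
  rw [e, abs_of_nonneg (mul_nonneg hξ (integral_nonneg fun x => by
    simp only [Pi.zero_apply]
    rw [← mul_sub]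
    exact mul_nonneg (by positivity) (hpos _)))]
  refine mul_le_mul_of_nonneg_left ?_ hξ
  rw [← integral_const_mul]
  refine integral_mono (i1.sub i2) ((integrable_sq hS.continuousOn_uBar).const_mul _) fun x => ?_
  rw [← mul_sub]
  have := mul_le_mul_of_nonneg_left (abs_sub_mul_tanh_le hε ⟪D.n x, S.uBar x⟫_ℝ)
    (show 0 ≤ 1 / 2 * ‖S.uBar x‖ ^ 2 by positivity)
  linarith

/-- Undoing the extrapolation, `ū = ⅔ ū³² + ⅓ uⁿ`; then `(a + b)² ≤ 2a² + 2b²` produces the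
constants. This passes from `ū` to the field whose energy enters `ξ`. -/
theorem IsSchemeStep.integral_uBar_sq_le (hS : IsSchemeStep D P Θ 0 0 0 0 S) :
    ∫ x in D.Γo, ‖S.uBar x‖ ^ 2 ∂surf d
      ≤ 8 / 9 * (∫ x in D.Γo, ‖S.uBar32 x‖ ^ 2 ∂surf d)
        + 2 / 9 * ∫ x in D.Γo, ‖S.uCur x‖ ^ 2 ∂surf d := by
  have i1 := integrable_sq hS.continuousOn_uBar
  have i2 := (integrable_sq hS.continuousOn_uBar32).const_mul (8 / 9)
  have i3 := (integrable_sq hS.uCur_reg.continuousOn).const_mul (2 / 9)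
  rw [← integral_const_mul, ← integral_const_mul, ← integral_add i2 i3]
  refine integral_mono i1 (i2.add i3) fun x => ?_
  have e : S.uBar x = (2 / 3 : ℝ) • S.uBar32 x + (1 / 3 : ℝ) • S.uCur x := by
    simp only [uBar32]; module
  have hn : ‖S.uBar x‖ ≤ 2 / 3 * ‖S.uBar32 x‖ + 1 / 3 * ‖S.uCur x‖ := by
    rw [e]
    refine (norm_add_le _ _).trans (le_of_eq ?_)
    rw [norm_smul, norm_smul]; norm_num
  have h2 := pow_le_pow_left₀ (norm_nonneg _) hn 2
  nlinarith [sq_nonneg (2 / 3 * ‖S.uBar32 x‖ - 1 / 3 * ‖S.uCur x‖)]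

/-- The boundary term of `E` gives the control; `|C0|` appears because `C0` may be negative. -/
theorem integral_sq_le_energy (v : E d → E d) :
    P.ν * P.D0 / 2 * (∫ x in D.Γo, ‖v x‖ ^ 2 ∂surf d) ≤ energy D P v + |P.C0| := by
  have h : 0 ≤ ∫ x in D.Ω, 1 / 2 * ‖v x‖ ^ 2 := integral_nonneg fun _ => by positivity
  have h2 := neg_abs_le P.C0
  rw [energy, integral_const_mul (μ := (surf d).restrict D.Γo)]
  linarith

/-- No bound on `ū` alone is available, but a large `ū³²` makes `ξ` small: the product `ξ E[ū³²]`
stays below `M²`. The lower bound `c` on the energy gives `ξ ≤ M²/c`, which handles the `C0` and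
`uⁿ` contributions. -/
theorem IsSchemeStep.xi_mul_integral_le {U0 δ : ℝ} (hU0 : 0 < U0) (hδ : 0 < δ)
    (hS : IsSchemeStep D P (smoothStep U0 δ) 0 0 0 0 S) {c M : ℝ} (hc : 0 < c)
    (hE : c ≤ energy D P S.uBar32) (hR : |S.R12| ≤ M)
    (hM : ∫ x in D.Γo, ‖S.uCur x‖ ^ 2 ∂surf d ≤ M) :
    S.ξ D P * ∫ x in D.Γo, ‖S.uBar x‖ ^ 2 ∂surf d
      ≤ 16 / 9 * (M ^ 2 * (1 + |P.C0| / c)) / (P.ν * P.D0) + 2 / 9 * (M ^ 2 / c * M) := by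
  have hE' := hc.trans_le hE
  have hM0 : 0 ≤ M := (abs_nonneg _).trans hR
  have hνD := mul_pos P.ν_pos P.D0_pos
  -- Stability itself turns the bound on the old `R12` into one on the new `R32`.
  have hR32 : S.R32 ^ 2 ≤ M ^ 2 := by
    have h1 := hS.smooth_decay hU0 hδ hE'
    have h2 := sq_le_sq' (neg_le_of_abs_le hR) (le_of_abs_le hR)
    linarith
  have hξ0 := xi_nonneg hE'
  have hξ : S.ξ D P ≤ M ^ 2 / c := by
    unfold ξ
    gcongr
  have hξE : S.ξ D P * energy D P S.uBar32 ≤ M ^ 2 := by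
    rw [ξ, div_mul_cancel₀ _ hE'.ne']; exact hR32
  have hX : S.ξ D P * ∫ x in D.Γo, ‖S.uBar32 x‖ ^ 2 ∂surf d
      ≤ 2 * (M ^ 2 * (1 + |P.C0| / c)) / (P.ν * P.D0) := by
    rw [le_div_iff₀ hνD]
    have h1 := mul_le_mul_of_nonneg_left (integral_sq_le_energy (D := D) (P := P) S.uBar32) hξ0
    have h2 := mul_le_mul_of_nonneg_right hξ (abs_nonneg P.C0)
    have h3 : M ^ 2 / c * |P.C0| = M ^ 2 * (|P.C0| / c) := by ring
    nlinarith
  calc _ ≤ S.ξ D P * (8 / 9 * (∫ x in D.Γo, ‖S.uBar32 x‖ ^ 2 ∂surf d)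
        + 2 / 9 * ∫ x in D.Γo, ‖S.uCur x‖ ^ 2 ∂surf d) :=
        mul_le_mul_of_nonneg_left hS.integral_uBar_sq_le hξ0
    _ = 8 / 9 * (S.ξ D P * ∫ x in D.Γo, ‖S.uBar32 x‖ ^ 2 ∂surf d)
        + 2 / 9 * (S.ξ D P * ∫ x in D.Γo, ‖S.uCur x‖ ^ 2 ∂surf d) := by ring
    _ ≤ 8 / 9 * (2 * (M ^ 2 * (1 + |P.C0| / c)) / (P.ν * P.D0)) + 2 / 9 * (M ^ 2 / c * M) := by
        have := (mul_le_mul_of_nonneg_left hM hξ0).trans (mul_le_mul_of_nonneg_right hξ hM0)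
        linarith
    _ = _ := by ring

end Step

end OpenFlow

theorem theorem1 {d : ℕ} (hd : d = 2 ∨ d = 3) (D : OpenFlow.FlowDomain d) (P : OpenFlow.Params)
    (U0 : ℝ) (hU0 : 0 < U0) :
    -- the scheme with the sharp step, which is the limit of the smoothed step
    (∀ Θ : ℝ → ℝ, OpenFlow.IsSharpStep Θ → ∀ S : OpenFlow.StepFields d,
      OpenFlow.IsSchemeStep D P Θ 0 0 0 0 S → 0 < OpenFlow.energy D P S.uBar32 →
        0 ≤ S.ξ D P ∧
        S.R32 ^ 2 - S.R12 ^ 2 = -(S.ξ D P * P.Δt * OpenFlow.dissipation D P S) ∧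
        -(S.ξ D P * P.Δt * OpenFlow.dissipation D P S) ≤ 0) ∧
    -- the scheme with a smoothed step of any width
    (∀ δ > 0, ∀ S : OpenFlow.StepFields d,
      OpenFlow.IsSchemeStep D P (OpenFlow.smoothStep U0 δ) 0 0 0 0 S →
      0 < OpenFlow.energy D P S.uBar32 →
        0 ≤ S.ξ D P ∧ S.R32 ^ 2 - S.R12 ^ 2 ≤ 0) ∧
    -- the limit of the schemes with smoothed steps whose widths tend to zero
    (∀ (δ : ℕ → ℝ) (S : ℕ → OpenFlow.StepFields d),
      (∀ k, 0 < δ k) → Tendsto δ atTop (𝓝 0) →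
      (∀ k, OpenFlow.IsSchemeStep D P (OpenFlow.smoothStep U0 (δ k)) 0 0 0 0 (S k)) →
      (∃ c > 0, ∀ k, c ≤ OpenFlow.energy D P (S k).uBar32) →
      (∃ M, ∀ k, |(S k).R12| ≤ M ∧ ∫ x in D.Γo, ‖(S k).uCur x‖ ^ 2 ∂OpenFlow.surf d ≤ M) →
        Tendsto (fun k => ((S k).R32 ^ 2 - (S k).R12 ^ 2)
          + (S k).ξ D P * P.Δt * OpenFlow.dissipation D P (S k)) atTop (𝓝 0)) := by
  refine ⟨fun Θ hΘ S hS hE => ⟨OpenFlow.xi_nonneg hE, hS.sharp_identity hΘ, ?_⟩,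
    fun δ hδ S hS hE => ⟨OpenFlow.xi_nonneg hE, hS.smooth_decay hU0 hδ hE⟩, ?_⟩
  · exact neg_nonpos.2 (mul_nonneg (mul_nonneg (OpenFlow.xi_nonneg hE) P.Δt_pos.le)
      OpenFlow.dissipation_nonneg)
  · rintro δ S hδ hδ0 hS ⟨c, hc, hE⟩ ⟨M, hM⟩
    -- `K` does not depend on `k`, so the factor `δ k` alone forces the defect to zero.
    set K := 16 / 9 * (M ^ 2 * (1 + |P.C0| / c)) / (P.ν * P.D0) + 2 / 9 * (M ^ 2 / c * M)
    have hlim : Tendsto (fun k => P.Δt * (U0 * δ k / 2) * K) atTop (𝓝 0) := by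
      simpa using ((((hδ0.const_mul U0).div_const 2).const_mul P.Δt).mul_const K)
    refine squeeze_zero_norm (fun k => ?_) hlim
    refine ((hS k).smooth_defect hU0 (hδ k) (hc.trans_le (hE k))).trans ?_
    have h := (hS k).xi_mul_integral_le hU0 (hδ k) hc (hE k) (hM k).1 (hM k).2
    have hpos : 0 ≤ P.Δt * (U0 * δ k / 2) :=
      mul_nonneg P.Δt_pos.le (div_nonneg (mul_pos hU0 (hδ k)).le zero_le_two)
    exact (le_of_eq (by ring)).trans (mul_le_mul_of_nonneg_left h hpos)
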